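/- Let $p$ be a prime number, let $A$ be the ring of integers of the Hilbert class field of $\mathbb{Q}(e^{2\pi i/p})$ (the maximal abelian extension of $\mathbb{Q}(e^{2\pi i/p})$ unramified at all finite and infinite places), and let $P$ be a prime ideal of $A$ containing $p$. Let $\mathcal{O} = A_P$ be the localization of $A$ at $P$, with maximal ideal $(\pi) = PA_P$. Let $G \subseteq GL_3(\mathcal{O})$ be a $p$-group, acting on the polynomial ring $R = \mathcal{O}[X,Y,Z]$ by linear substitutions of the variables, fixing $\mathcal{O}$. Assume that the natural map $G \to GL_3(\mathcal{O}/(\pi))$ is trivial, i.e. every element of $G$ is congruent to the identity matrix modulo $\pi$. Then the ring of invariants $R^G$ is a Cohen–Macaulay ring (it is Noetherian, and for each of its maximal ideals $\mathfrak{m}$ the depth of the local ring $(R^G)_{\mathfrak{m}}$ equals its Krull dimension). -/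

import Mathlib

open NumberField

/-! ### Hilbert class fields -/

/-- `L / K` is a finite abelian extension of fields which is unramified at every prime ideal of
the ring of integers of `L` and at every infinite place. -/
structure IsUnramifiedAbelianExtension (K L : Type*) [Field K] [Field L] [Algebra K L] : Prop where
  finiteDimensional : FiniteDimensional K L
  isAbelianGalois : IsAbelianGalois K L
  isUnramifiedAt : ∀ (Q : Ideal (𝓞 L)) [Q.IsPrime], Algebra.IsUnramifiedAt (𝓞 K) Q
  isUnramifiedAtInfinitePlaces : IsUnramifiedAtInfinitePlaces K L

/-- `H` is the Hilbert class field of the number field `K`: the maximal unramified abelian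
extension of `K`, i.e. `H / K` is one, and every unramified abelian extension of `K`
(inside an algebraic closure of `K`) embeds into `H` over `K`. -/
structure IsHilbertClassField (K H : Type*) [Field K] [NumberField K] [Field H] [NumberField H]
    [Algebra K H] : Prop extends IsUnramifiedAbelianExtension K H where
  maximal : ∀ L : IntermediateField K (AlgebraicClosure K),
    IsUnramifiedAbelianExtension K L → Nonempty (L →ₐ[K] H)

/-! ### Linear group actions on polynomial rings -/

/-- The linear action of `GL_n(R)` on the polynomial ring `R[X_1, …, X_n]`, fixing `R`:
the matrix `g` acts on the linear forms with basis `X_1, …, X_n` in the usual way, that is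
`g • X_j = ∑ i, g_{ij} X_i`. -/
noncomputable def linearAction (n : ℕ) (R : Type*) [CommRing R] :
    GL (Fin n) R →* (MvPolynomial (Fin n) R →ₐ[R] MvPolynomial (Fin n) R) where
  toFun g := MvPolynomial.aeval fun j => ∑ i, MvPolynomial.C (g.1 i j) * MvPolynomial.X i
  map_one' := by
    ext j : 1
    simp [Matrix.one_apply]
  map_mul' g h := by
    ext j : 1
    simp only [Units.val_mul, Matrix.mul_apply, MvPolynomial.aeval_X, AlgHom.mul_apply, map_sum,
      map_mul, MvPolynomial.algHom_C, MvPolynomial.algebraMap_eq, Finset.sum_mul, Finset.mul_sum]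
    rw [Finset.sum_comm]
    refine Finset.sum_congr rfl fun k _ => Finset.sum_congr rfl fun i _ => ?_
    ring

/-- The ring of invariants `R[X_1, …, X_n]^G` of a subgroup `G` of `GL_n(R)`. -/
noncomputable def invariantRing {n : ℕ} {R : Type*} [CommRing R] (G : Subgroup (GL (Fin n) R)) :
    Subalgebra R (MvPolynomial (Fin n) R) :=
  ⨅ g ∈ G, AlgHom.equalizer (linearAction n R g) (AlgHom.id R _)

theorem mem_invariantRing {n : ℕ} {R : Type*} [CommRing R] {G : Subgroup (GL (Fin n) R)}
    {f : MvPolynomial (Fin n) R} :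
    f ∈ invariantRing G ↔ ∀ g ∈ G, linearAction n R g f = f := by
  simp [invariantRing, Algebra.mem_iInf, AlgHom.mem_equalizer]

/-! ### Cohen–Macaulay rings -/

/-- The depth of a local ring: the supremum of the lengths of the regular sequences
contained in its maximal ideal. -/
noncomputable def localDepth (R : Type*) [CommRing R] [IsLocalRing R] : ℕ∞ :=
  ⨆ (rs : List R) (_ : RingTheory.Sequence.IsRegular R rs)
    (_ : ∀ r ∈ rs, r ∈ IsLocalRing.maximalIdeal R), (rs.length : ℕ∞)

/-- A Noetherian local ring is Cohen–Macaulay if its depth equals its Krull dimension. -/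
structure IsCohenMacaulayLocalRing (R : Type*) [CommRing R] [IsLocalRing R] : Prop where
  isNoetherianRing : IsNoetherianRing R
  depth_eq_dim : (localDepth R : WithBot ℕ∞) = ringKrullDim R

/-- A Noetherian ring is Cohen–Macaulay if all its localizations at maximal ideals are
Cohen–Macaulay local rings. -/
structure IsCohenMacaulayRing (R : Type*) [CommRing R] : Prop where
  isNoetherianRing : IsNoetherianRing R
  localization : ∀ (m : Ideal R) [m.IsMaximal], IsCohenMacaulayLocalRing (Localization.AtPrime m)

/-! The congruence condition forces `G` to be diagonalizable over the base ring, and invariants of a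
diagonal group of exponent `p` are free over a polynomial ring.

Let `ζ` be a primitive `p`-th root of unity and `π = ζ - 1`. The Hilbert class field enters through
unramifiedness at `P`: since `π` generates the prime of `𝓞 K` above `p`, it still generates the
maximal ideal of the localization (`map_span_zeta_sub_one_eq_maximalIdeal`). The key rigidity
statement is `eq_zero_of_pow_eq_one`: a matrix congruent to `1` modulo `π²` with `p`-th power `1` is
`1`. Since `π ∣ p`, `p`-th powers of elements of `G` are `1` modulo `π²`, and so are commutators;
hence `G` has exponent dividing `p` and is abelian. Writing `g = 1 + π N`, the matrix `N` is a root
of `∏ (X - a_i)` with `a_i = (ζ^i - 1)/(ζ - 1)`. The differences of the `a_i` are units, so all the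
`N` are diagonalized by one invertible matrix (`IsPGroup.exists_diagonalization`).

After conjugation, an invariant is a combination of invariant monomials, and every `X_i ^ p` is
invariant. Sorting exponents modulo `p` shows that the invariant ring is finite free over the
polynomial ring in the `X_i ^ p`.

Cohen–Macaulayness is carried by `HasRegularParameters`, whose transfer along flat maps and
polynomial extensions needs no dimension formula. It starts from Dedekind domains; dimension appears
only in `HasRegularParameters.isCohenMacaulayLocalRing`. -/

open IsLocalRing RingTheory.Sequence

/-! ### Regular systems of parameters up to radical -/

/-- A local ring has a regular system of parameters up to radical if some regular sequence lies in
no other prime ideal than the maximal one. -/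
def HasRegularParameters (D : Type*) [CommRing D] [IsLocalRing D] : Prop :=
  ∃ rs : List D, RingTheory.Sequence.IsWeaklyRegular D rs ∧
    (∀ r ∈ rs, r ∈ IsLocalRing.maximalIdeal D) ∧
    ∀ Q : Ideal D, Q.IsPrime → (∀ r ∈ rs, r ∈ Q) → Q = IsLocalRing.maximalIdeal D

/-- All localizations at primes have a regular system of parameters up to radical. -/
def LocallyHasRegularParameters (R : Type*) [CommRing R] : Prop :=
  ∀ (p : Ideal R) [p.IsPrime], HasRegularParameters (Localization.AtPrime p)


/-- Flatness preserves the regular sequence; `hfib` says that the closed fibre has a single prime,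
so the image sequence still cuts out just the closed point. -/
theorem HasRegularParameters.of_flat {D E : Type*} [CommRing D] [IsLocalRing D] [CommRing E]
    [IsLocalRing E] [Algebra D E] [IsLocalHom (algebraMap D E)] [Module.Flat D E]
    (hfib : ∀ Q : Ideal E, Q.IsPrime → (maximalIdeal D).map (algebraMap D E) ≤ Q →
      Q = maximalIdeal E)
    (hD : HasRegularParameters D) : HasRegularParameters E := by
  obtain ⟨rs, hreg, hmem, hrad⟩ := hD
  refine ⟨rs.map (algebraMap D E), hreg.of_flat, ?_, fun Q hQ hrs => ?_⟩
  · intro r hr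
    obtain ⟨s, hs, rfl⟩ := List.mem_map.mp hr
    have := hmem s hs
    rw [mem_maximalIdeal] at this ⊢
    simpa using this
  · refine hfib Q hQ ?_
    rw [Ideal.map_le_iff_le_comap]
    exact (hrad (Q.comap (algebraMap D E)) inferInstance fun r hr =>
      hrs _ (List.mem_map_of_mem hr)).ge

theorem HasRegularParameters.of_ringEquiv {D E : Type*} [CommRing D] [IsLocalRing D] [CommRing E]
    [IsLocalRing E] (e : D ≃+* E) (hD : HasRegularParameters D) : HasRegularParameters E := by
  let := e.toRingHom.toAlgebra
  have : Module.Flat D E := RingHom.Flat.of_bijective (f := e.toRingHom) e.bijective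
  have : IsLocalHom (algebraMap D E) := ⟨fun a ha => by
    have := ha.map e.symm
    rwa [show e.symm (algebraMap D E a) = a from e.symm_apply_apply a] at this⟩
  refine hD.of_flat fun Q hQ hle => ?_
  have : (maximalIdeal D).map (algebraMap D E) = maximalIdeal E := map_ringEquiv_maximalIdeal e
  rw [this] at hle
  exact ((maximalIdeal.isMaximal E).eq_of_le hQ.ne_top hle).symm

theorem LocallyHasRegularParameters.of_ringEquiv {R S : Type*} [CommRing R] [CommRing S]
    (e : R ≃+* S) (hR : LocallyHasRegularParameters R) : LocallyHasRegularParameters S := by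
  intro p hp
  exact (hR (p.comap e)).of_ringEquiv (IsLocalization.ringEquivOfRingEquiv
    (Localization.AtPrime (p.comap e)) (Localization.AtPrime p) e (e.map_primeCompl_comap_eq p))

/-- A regular sequence of length `k` lowers the dimension by exactly `k`. This bounds the depth by
the dimension, with equality once the quotient has dimension zero. -/
theorem HasRegularParameters.isCohenMacaulayLocalRing {D : Type*} [CommRing D] [IsLocalRing D]
    [IsNoetherianRing D] (hD : HasRegularParameters D) : IsCohenMacaulayLocalRing D := by
  refine ⟨inferInstance, le_antisymm ?_ ?_⟩
  · rw [← maximalIdeal_height_eq_ringKrullDim, WithBot.coe_le_coe]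
    refine iSup_le fun rs => iSup_le fun hrs => iSup_le fun _ => ?_
    have h := ringKrullDim_add_length_eq_ringKrullDim_of_isRegular rs hrs
    have : Nontrivial (D ⧸ Ideal.ofList rs) := by
      rw [Ideal.Quotient.nontrivial_iff]
      intro htop
      exact hrs.2 (by simp [htop])
    have h0 : (0 : WithBot ℕ∞) ≤ ringKrullDim (D ⧸ Ideal.ofList rs) := ringKrullDim_nonneg_of_nontrivial
    rw [← WithBot.coe_le_coe, maximalIdeal_height_eq_ringKrullDim, ← h]
    exact le_add_of_nonneg_left h0
  · obtain ⟨rs, hreg, hmem, hrad⟩ := hD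
    have hreg' : IsRegular D rs := .of_isWeaklyRegular_of_mem_maximalIdeal D hmem hreg
    have h := ringKrullDim_add_length_eq_ringKrullDim_of_isRegular rs hreg'
    have h0 : ringKrullDim (D ⧸ Ideal.ofList rs) ≤ 0 := by
      rw [← Nat.cast_zero, ← Ring.krullDimLE_iff]
      refine Ring.KrullDimLE.mk₀ fun I hI => ?_
      have hIc := hrad (I.comap (Ideal.Quotient.mk (Ideal.ofList rs))) inferInstance fun r hr => by
        have : Ideal.Quotient.mk (Ideal.ofList rs) r = 0 :=
          Ideal.Quotient.eq_zero_iff_mem.mpr (Ideal.subset_span hr)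
        rw [Ideal.mem_comap, this]
        exact I.zero_mem
      have := maximalIdeal.isMaximal D
      rw [← hIc] at this
      have hsurj := Ideal.Quotient.mk_surjective (I := Ideal.ofList rs)
      have h := Ideal.map_eq_top_or_isMaximal_of_surjective _ hsurj this
      rw [Ideal.map_comap_of_surjective _ hsurj] at h
      exact h.resolve_left hI.ne_top
    rw [← h]
    refine (add_le_add_left h0 _).trans ?_
    rw [zero_add]
    have : (rs.length : ℕ∞) ≤ localDepth D :=
      le_iSup_of_le rs (le_iSup_of_le hreg' (le_iSup_of_le hmem le_rfl))
    exact_mod_cast this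

theorem Polynomial.isSMulRegular_quotient_map_C_of_monic {D : Type*} [CommRing D] (I : Ideal D)
    {y : Polynomial D} (hy : y.Monic) :
    IsSMulRegular (Polynomial D ⧸ I.map Polynomial.C) y := by
  refine .of_right_eq_zero_of_smul fun x => ?_
  obtain ⟨f, rfl⟩ := Ideal.Quotient.mk_surjective x
  intro h
  replace h : Ideal.Quotient.mk (I.map Polynomial.C) (y * f) = 0 := h
  rw [Ideal.Quotient.eq_zero_iff_mem, ← Ideal.mk_ker (I := I), ← Polynomial.ker_mapRingHom,
    RingHom.mem_ker, map_mul] at h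
  rw [Ideal.Quotient.eq_zero_iff_mem, ← Ideal.mk_ker (I := I), ← Polynomial.ker_mapRingHom,
    RingHom.mem_ker]
  exact ((hy.map (Ideal.Quotient.mk I)).mul_right_eq_zero_iff).mp h

/-- The fibre over the closed point is a polynomial ring over a field. At its generic point the flat
case applies directly; at a closed point, a monic lift `y` of the generator of the prime extends the
sequence by one. -/
theorem HasRegularParameters.polynomial {D : Type*} [CommRing D] [IsLocalRing D]
    (hD : HasRegularParameters D) (p : Ideal (Polynomial D)) [p.IsPrime]
    (hp : p.comap Polynomial.C = maximalIdeal D) :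
    HasRegularParameters (Localization.AtPrime p) := by
  have hmap : (maximalIdeal D).map Polynomial.C ≤ p := by
    rw [← hp]; exact Ideal.map_comap_le
  by_cases heq : p = (maximalIdeal D).map Polynomial.C
  · have : Module.Flat D (Localization.AtPrime p) :=
      Module.Flat.trans D (Polynomial D) (Localization.AtPrime p)
    have : IsLocalHom (algebraMap D (Localization.AtPrime p)) := by
      refine ((local_hom_TFAE (algebraMap D (Localization.AtPrime p))).out 0 4).mpr ?_
      rw [IsScalarTower.algebraMap_eq D (Polynomial D), ← Ideal.comap_comap,
        Polynomial.algebraMap_eq, ← Ideal.under_def, Localization.AtPrime.under_maximalIdeal, hp]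
    refine hD.of_flat fun Q hQ hle => ?_
    rw [IsScalarTower.algebraMap_eq D (Polynomial D), ← Ideal.map_map, Polynomial.algebraMap_eq,
      ← heq, Localization.AtPrime.map_eq_maximalIdeal] at hle
    exact ((maximalIdeal.isMaximal _).eq_of_le hQ.ne_top hle).symm
  · obtain ⟨rs, hreg, hmem, hrad⟩ := hD
    have hmax : (p.comap Polynomial.C).IsMaximal := by
      rw [hp]; exact maximalIdeal.isMaximal D
    obtain ⟨y, hymonic, hy⟩ := Polynomial.exists_monic_span_sup_map_eq D p hmax
      (by rw [hp]; exact heq)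
    rw [hp] at hy
    have hyp : y ∈ p := by
      rw [hy]; exact Ideal.mem_sup_right (Ideal.mem_span_singleton_self y)
    have hreg' : IsWeaklyRegular (Polynomial D) (rs.map Polynomial.C ++ [y]) := by
      rw [isWeaklyRegular_append_iff]
      refine ⟨hreg.of_flat, ?_⟩
      rw [isWeaklyRegular_singleton_iff, ← Ideal.map_ofList, smul_eq_mul, Ideal.mul_top]
      exact Polynomial.isSMulRegular_quotient_map_C_of_monic _ hymonic
    have hmem' : ∀ r ∈ rs.map Polynomial.C ++ [y], r ∈ p := by
      intro r hr
      rcases List.mem_append.mp hr with h | h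
      · obtain ⟨s, hs, rfl⟩ := List.mem_map.mp h
        exact hmap (Ideal.mem_map_of_mem _ (hmem s hs))
      · rwa [List.mem_singleton.mp h]
    refine ⟨(rs.map Polynomial.C ++ [y]).map (algebraMap _ _),
      hreg'.of_isLocalization _ p.primeCompl, ?_, ?_⟩
    · intro r hr
      obtain ⟨s, hs, rfl⟩ := List.mem_map.mp hr
      exact (IsLocalization.AtPrime.to_map_mem_maximal_iff _ p s).mpr (hmem' s hs)
    · intro Q hQ hrs
      have hrs' : ∀ r ∈ rs.map Polynomial.C ++ [y], algebraMap _ (Localization.AtPrime p) r ∈ Q :=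
        fun r hr => hrs _ (List.mem_map_of_mem hr)
      have h1 : (Q.comap (algebraMap (Polynomial D) _)).comap Polynomial.C = maximalIdeal D :=
        hrad _ inferInstance fun r hr =>
          hrs' _ (List.mem_append_left _ (List.mem_map_of_mem hr))
      have h2 : p ≤ Q.comap (algebraMap (Polynomial D) (Localization.AtPrime p)) := by
        refine hy.le.trans ?_
        rw [sup_le_iff, Ideal.span_singleton_le_iff_mem, Ideal.map_le_iff_le_comap]
        exact ⟨h1.ge, hrs' _ (List.mem_append_right _ (List.mem_singleton_self y))⟩
      rw [← Ideal.map_le_iff_le_comap, Localization.AtPrime.map_eq_maximalIdeal] at h2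
      exact ((maximalIdeal.isMaximal _).eq_of_le hQ.ne_top h2).symm

/-- Localizing at `p` factors through inverting the complement of `q = p ∩ R`, which reduces to a
local coefficient ring. -/
theorem LocallyHasRegularParameters.polynomial {R : Type*} [CommRing R]
    (hR : LocallyHasRegularParameters R) : LocallyHasRegularParameters (Polynomial R) := by
  intro p hp
  let q := p.comap Polynomial.C
  let S := Polynomial (Localization.AtPrime q)
  let pc := Submonoid.map Polynomial.C.toMonoidHom q.primeCompl
  let : Algebra (Polynomial R) S := Polynomial.algebra R (Localization.AtPrime q)
  have : IsLocalization pc S := Polynomial.isLocalization _ _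
  let pS := p.map (algebraMap (Polynomial R) S)
  have disj : Disjoint (pc : Set (Polynomial R)) (p : Set (Polynomial R)) := by
    simpa [pc, q] using! Set.disjoint_image_left.mpr
      (Set.disjoint_compl_left_iff_subset.mpr (fun _ a ↦ a))
  have : pS.IsPrime := IsLocalization.isPrime_of_isPrime_disjoint pc _ _ ‹_› disj
  have : IsLocalization.AtPrime (Localization.AtPrime pS) p := by
    convert IsLocalization.isLocalization_isLocalization_atPrime_isLocalization pc
      (Localization.AtPrime pS) pS
    exact (IsLocalization.under_map_of_isPrime_disjoint pc _ ‹_› disj).symm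
  have eq : pS.comap Polynomial.C = maximalIdeal (Localization.AtPrime q) := by
    rw [← IsLocalization.map_under q.primeCompl _ (pS.comap Polynomial.C),
      ← IsLocalization.map_under q.primeCompl _ (maximalIdeal (Localization.AtPrime q))]
    simp only [Ideal.comap_comap, S, pS]
    rw [← Polynomial.algebraMap_eq (R := Localization.AtPrime q),
      ← IsScalarTower.algebraMap_eq R (Localization.AtPrime q) (Polynomial (Localization.AtPrime q)),
      IsScalarTower.algebraMap_eq R (Polynomial R) (Polynomial (Localization.AtPrime q)),
      ← Ideal.comap_comap, ← Ideal.under_def (Polynomial R),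
      IsLocalization.under_map_of_isPrime_disjoint pc _ ‹_› disj]
    simp [q, IsLocalization.AtPrime.under_maximalIdeal (Localization.AtPrime q) q]
  exact ((hR q).polynomial pS eq).of_ringEquiv (IsLocalization.algEquiv p.primeCompl
    (Localization.AtPrime pS) (Localization.AtPrime p)).toRingEquiv

theorem LocallyHasRegularParameters.mvPolynomial {R : Type*} [CommRing R]
    (hR : LocallyHasRegularParameters R) (ι : Type*) [Finite ι] :
    LocallyHasRegularParameters (MvPolynomial ι R) := by
  induction ι using Finite.induction_empty_option with
  | of_equiv e H => exact H.of_ringEquiv (MvPolynomial.renameEquiv _ e).toRingEquiv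
  | h_empty => exact hR.of_ringEquiv (MvPolynomial.isEmptyRingEquiv R _).symm
  | h_option IH =>
    exact IH.polynomial.of_ringEquiv (MvPolynomial.optionEquivLeft _ _).toRingEquiv.symm

theorem HasRegularParameters.of_isDomain_of_isPrincipalIdealRing (D : Type*) [CommRing D]
    [IsLocalRing D] [IsDomain D] [IsPrincipalIdealRing D] : HasRegularParameters D := by
  by_cases hD : IsField D
  · refine ⟨[], by simp, by simp, fun Q hQ _ => ?_⟩
    rw [isField_iff_maximalIdeal_eq.mp hD]
    exact le_bot_iff.mp ((le_maximalIdeal hQ.ne_top).trans (isField_iff_maximalIdeal_eq.mp hD).le)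
  · obtain ⟨x, hx⟩ := (IsPrincipalIdealRing.principal (maximalIdeal D)).principal
    have hx0 : x ≠ 0 := by
      rintro rfl
      refine hD (isField_iff_maximalIdeal_eq.mpr ?_)
      simpa using hx
    refine ⟨[x], ?_, ?_, fun Q hQ hxQ => ?_⟩
    · rw [isWeaklyRegular_singleton_iff]
      refine .of_right_eq_zero_of_smul fun y hy => ?_
      exact (mul_eq_zero.mp hy).resolve_left hx0
    · simp [hx, Submodule.mem_span_singleton_self]
    · refine ((maximalIdeal.isMaximal D).eq_of_le hQ.ne_top ?_).symm
      rw [hx, Submodule.span_singleton_le_iff_mem]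
      exact hxQ x (List.mem_singleton_self x)

theorem LocallyHasRegularParameters.of_isDedekindDomain (R : Type*) [CommRing R]
    [IsDedekindDomain R] : LocallyHasRegularParameters R := by
  intro p hp
  by_cases eqbot : p = ⊥
  · let : Field (Localization.AtPrime p) := IsField.toField <| by
      simp [isField_iff_maximalIdeal_eq, ← Localization.AtPrime.map_eq_maximalIdeal, eqbot]
    exact .of_isDomain_of_isPrincipalIdealRing _
  · have := IsLocalization.AtPrime.isDiscreteValuationRing_of_dedekind_domain
      R eqbot (Localization.AtPrime p)
    exact .of_isDomain_of_isPrincipalIdealRing _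

theorem LocallyHasRegularParameters.of_finite_of_flat {B A : Type*} [CommRing B] [CommRing A]
    [Algebra B A] [Module.Finite B A] [Module.Flat B A] (hB : LocallyHasRegularParameters B) :
    LocallyHasRegularParameters A := by
  intro m hm
  let n := m.under B
  let := Localization.AtPrime.algebraOfLiesOver n m
  refine (hB n).of_flat fun Q hQ hle => ?_
  have hle' : n ≤ (Q.comap (algebraMap A (Localization.AtPrime m))).comap (algebraMap B A) := by
    rw [Ideal.comap_comap, ← IsScalarTower.algebraMap_eq,
      IsScalarTower.algebraMap_eq B (Localization.AtPrime n), ← Ideal.comap_comap,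
      ← Ideal.map_le_iff_le_comap, Localization.AtPrime.map_eq_maximalIdeal,
      ← Ideal.map_le_iff_le_comap]
    exact hle
  have hQm : Q.comap (algebraMap A (Localization.AtPrime m)) ≤ m := by
    refine (Ideal.comap_mono (le_maximalIdeal hQ.ne_top)).trans ?_
    exact (Localization.AtPrime.under_maximalIdeal (I := m)).le
  -- Incomparability: in an integral extension, two nested primes over the same prime coincide.
  have heq : Q.comap (algebraMap A (Localization.AtPrime m)) = m := by
    by_contra hne
    have hlt := Ideal.IsIntegral.comap_lt_comap (R := B) (lt_of_le_of_ne hQm hne)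
    exact hlt.not_ge hle'
  refine ((maximalIdeal.isMaximal _).eq_of_le hQ.ne_top ?_).symm
  rw [← Localization.AtPrime.map_eq_maximalIdeal, Ideal.map_le_iff_le_comap]
  exact heq.ge

theorem LocallyHasRegularParameters.isCohenMacaulayRing {R : Type*} [CommRing R]
    [IsNoetherianRing R] (hR : LocallyHasRegularParameters R) : IsCohenMacaulayRing R :=
  ⟨inferInstance, fun m _ =>
    have := IsLocalization.isNoetherianRing m.primeCompl (Localization.AtPrime m) inferInstance
    (hR m).isCohenMacaulayLocalRing⟩

/-! ### Simultaneous diagonalization over local rings -/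

/-- Lagrange interpolation by induction: `N - a j` scales an `a i`-eigenvector by the unit `a i - a
j`, so it is onto the span of the other eigenvectors. The stable submodule `E` will be a joint
eigenspace of operators already treated. -/
theorem Module.End.mem_span_eigenvectors {R M ι : Type*} [CommRing R] [AddCommGroup M] [Module R M]
    (N : Module.End R M) (E : Submodule R M) (hE : ∀ v ∈ E, N v ∈ E) (a : ι → R) (t : Finset ι)
    (ha : ∀ i ∈ t, ∀ j ∈ t, i ≠ j → IsUnit (a i - a j)) (v : M) (hv : v ∈ E)
    (hN : Polynomial.aeval N (∏ i ∈ t, (Polynomial.X - Polynomial.C (a i))) v = 0) :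
    v ∈ Submodule.span R {w | w ∈ E ∧ ∃ i ∈ t, N w = a i • w} := by
  classical
  induction t using Finset.induction_on generalizing v with
  | empty => simp_all
  | insert j t hj ih =>
    have hsub : Submodule.span R {w | w ∈ E ∧ ∃ i ∈ t, N w = a i • w} ≤
        Submodule.span R {w | w ∈ E ∧ ∃ i ∈ insert j t, N w = a i • w} :=
      Submodule.span_mono fun w ⟨hw, i, hi, h⟩ => ⟨hw, i, Finset.mem_insert_of_mem hi, h⟩
    have hspan : Submodule.span R {w | w ∈ E ∧ ∃ i ∈ t, N w = a i • w} ≤ E :=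
      Submodule.span_le.mpr fun w hw => hw.1
    have hw := ih (fun i hi k hk => ha i (Finset.mem_insert_of_mem hi) k
      (Finset.mem_insert_of_mem hk)) (N v - a j • v) (E.sub_mem (hE v hv) (E.smul_mem _ hv)) (by
        rw [Finset.prod_insert hj, mul_comm, map_mul] at hN
        simpa [Algebra.algebraMap_eq_smul_one] using hN)
    have key : ∀ w ∈ Submodule.span R {w | w ∈ E ∧ ∃ i ∈ t, N w = a i • w},
        ∃ u ∈ Submodule.span R {w | w ∈ E ∧ ∃ i ∈ t, N w = a i • w}, N u - a j • u = w := by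
      intro w hw
      induction hw using Submodule.span_induction with
      | mem w hw =>
        obtain ⟨hwE, i, hi, h⟩ := hw
        obtain ⟨u, hu⟩ := ha i (Finset.mem_insert_of_mem hi) j (Finset.mem_insert_self j t)
          (by rintro rfl; exact hj hi)
        refine ⟨(↑u⁻¹ : R) • w,
          Submodule.smul_mem _ _ (Submodule.subset_span ⟨hwE, i, hi, h⟩), ?_⟩
        rw [map_smul, h, smul_comm (a j), ← smul_sub, ← sub_smul, ← hu, smul_smul, Units.inv_mul,
          one_smul]
      | zero => exact ⟨0, Submodule.zero_mem _, by simp⟩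
      | add x y _ _ hx hy =>
        obtain ⟨u, hu, rfl⟩ := hx
        obtain ⟨u', hu', rfl⟩ := hy
        exact ⟨u + u', Submodule.add_mem _ hu hu', by rw [map_add, smul_add]; abel⟩
      | smul c x _ hx =>
        obtain ⟨u, hu, rfl⟩ := hx
        exact ⟨c • u, Submodule.smul_mem _ _ hu, by rw [map_smul, smul_sub, smul_comm c]⟩
    -- Both `u` and `v` have the same image under `N - a j`, so `v - u` is an `a j`-eigenvector.
    obtain ⟨u, hu, huv⟩ := key _ hw
    rw [← sub_add_cancel v u]
    refine Submodule.add_mem _ (Submodule.subset_span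
      ⟨E.sub_mem hv (hspan hu), j, Finset.mem_insert_self j t, ?_⟩) (hsub hu)
    rw [map_sub, smul_sub, sub_eq_sub_iff_sub_eq_sub, huv]

theorem Module.End.span_common_eigenvectors_eq_top {R M ι : Type*} [CommRing R] [AddCommGroup M]
    [Module R M] (a : ι → R) (t : Finset ι)
    (ha : ∀ i ∈ t, ∀ j ∈ t, i ≠ j → IsUnit (a i - a j)) (s : Finset (Module.End R M))
    (hcomm : ∀ x ∈ s, ∀ y ∈ s, Commute x y)
    (hs : ∀ N ∈ s, Polynomial.aeval N (∏ i ∈ t, (Polynomial.X - Polynomial.C (a i))) = 0) :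
    Submodule.span R {v : M | ∀ N ∈ s, ∃ c : R, N v = c • v} = ⊤ := by
  classical
  induction s using Finset.induction_on with
  | empty => simp
  | insert N s hN ih =>
    rw [← top_le_iff, ← ih (fun x hx y hy => hcomm x (Finset.mem_insert_of_mem hx) y
      (Finset.mem_insert_of_mem hy)) (fun x hx => hs x (Finset.mem_insert_of_mem hx)),
      Submodule.span_le]
    intro v hv
    choose! c hc using hv
    let E : Submodule R M := ⨅ x ∈ s, LinearMap.ker (x - c x • (1 : Module.End R M))
    have hE : ∀ w, w ∈ E ↔ ∀ x ∈ s, x w = c x • w := by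
      intro w
      simp [E, Submodule.mem_iInf, sub_eq_zero]
    have hmem := N.mem_span_eigenvectors E (fun w hw => by
      rw [hE] at hw ⊢
      intro x hx
      have hxN := hcomm x (Finset.mem_insert_of_mem hx) N (Finset.mem_insert_self N s)
      have := LinearMap.congr_fun hxN.eq w
      rw [Module.End.mul_apply, Module.End.mul_apply] at this
      rw [this, hw x hx, map_smul]) a t ha v ((hE v).mpr hc)
      (by rw [hs N (Finset.mem_insert_self N s)]; rfl)
    refine Submodule.span_mono ?_ hmem
    rintro w ⟨hw, i, -, hi⟩ x hx
    rcases Finset.mem_insert.mp hx with rfl | hx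
    · exact ⟨a i, hi⟩
    · exact ⟨c x, (hE w).mp hw x hx⟩

theorem Module.End.exists_basis_common_eigenvectors {R M : Type*} {ι : Type*} [CommRing R]
    [IsLocalRing R] [IsNoetherianRing R] [AddCommGroup M] [Module R M] [Module.Finite R M]
    [Module.Free R M] (a : ι → R) (t : Finset ι)
    (ha : ∀ i ∈ t, ∀ j ∈ t, i ≠ j → IsUnit (a i - a j)) (S : Set (Module.End R M))
    (hcomm : ∀ x ∈ S, ∀ y ∈ S, Commute x y)
    (hS : ∀ N ∈ S, Polynomial.aeval N (∏ i ∈ t, (Polynomial.X - Polynomial.C (a i))) = 0) :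
    ∃ b : Module.Basis (Fin (Module.finrank R M)) R M, ∀ N ∈ S, ∀ i, ∃ c : R, N (b i) = c • b i := by
  -- Finitely many operators of `S` span all of them linearly, and common eigenvectors of these are
  -- eigenvectors of the whole span. Over a local ring, a basis can then be chosen among the
  -- spanning eigenvectors.
  obtain ⟨s, hsS, hs⟩ := Submodule.fg_span_iff_fg_span_finset_subset S |>.mp
    (IsNoetherian.noetherian (Submodule.span R S))
  have htop := span_common_eigenvectors_eq_top a t ha s (fun x hx y hy => hcomm x (hsS hx) y (hsS hy))
    fun N hN => hS N (hsS hN)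
  have := Module.finitePresentation_of_finite R M
  obtain ⟨κ, f, b, hb⟩ := Module.exists_basis_of_span_of_flat
    (fun v : {v : M | ∀ N ∈ s, ∃ c : R, N v = c • v} => (v : M)) (by simpa using htop)
  refine ⟨b.reindex (b.indexEquiv (Module.finBasis R M)), fun N hN i => ?_⟩
  rw [Module.Basis.reindex_apply]
  generalize (b.indexEquiv (Module.finBasis R M)).symm i = k
  have hN' : N ∈ Submodule.span R (s : Set (Module.End R M)) := hs ▸ Submodule.subset_span hN
  clear hN
  induction hN' using Submodule.span_induction with
  | mem N hN =>
    rw [hb]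
    exact (f k).2 N hN
  | zero => exact ⟨0, by simp⟩
  | add x y _ _ hx hy =>
    obtain ⟨c, hc⟩ := hx
    obtain ⟨c', hc'⟩ := hy
    exact ⟨c + c', by rw [LinearMap.add_apply, hc, hc', add_smul]⟩
  | smul r x _ hx =>
    obtain ⟨c, hc⟩ := hx
    exact ⟨r * c, by rw [LinearMap.smul_apply, hc, mul_smul]⟩

theorem Matrix.exists_simultaneous_diagonalization {R ι : Type*} [CommRing R] [IsLocalRing R]
    [IsNoetherianRing R] {n : ℕ} (a : ι → R) (t : Finset ι)
    (ha : ∀ i ∈ t, ∀ j ∈ t, i ≠ j → IsUnit (a i - a j)) (S : Set (Matrix (Fin n) (Fin n) R))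
    (hcomm : ∀ x ∈ S, ∀ y ∈ S, Commute x y)
    (hS : ∀ N ∈ S, Polynomial.aeval N (∏ i ∈ t, (Polynomial.X - Polynomial.C (a i))) = 0) :
    ∃ Q : GL (Fin n) R, ∀ N ∈ S, ∃ d : Fin n → R, N * Q.1 = Q.1 * Matrix.diagonal d := by
  obtain ⟨b, hb⟩ := Module.End.exists_basis_common_eigenvectors (M := Fin n → R) a t ha
    (Matrix.toLinAlgEquiv' '' S)
    (by
      rintro _ ⟨x, hx, rfl⟩ _ ⟨y, hy, rfl⟩
      exact (hcomm x hx y hy).map Matrix.toLinAlgEquiv')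
    (by
      rintro _ ⟨x, hx, rfl⟩
      rw [← AlgEquiv.coe_toAlgHom, Polynomial.aeval_algHom_apply, hS x hx, map_zero])
  let b' := b.reindex (finCongr (Module.finrank_fin_fun R))
  let e := Pi.basisFun R (Fin n)
  let Q : GL (Fin n) R := ⟨e.toMatrix b', b'.toMatrix e, e.toMatrix_mul_toMatrix_flip b',
    b'.toMatrix_mul_toMatrix_flip e⟩
  have hQ : ∀ i j, Q.1 i j = b' j i := fun i j => by
    simp [Q, e, Module.Basis.toMatrix_apply]
  refine ⟨Q, fun N hN => ?_⟩
  choose d hd using fun j : Fin n =>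
    hb _ ⟨N, hN, rfl⟩ ((finCongr (Module.finrank_fin_fun R)).symm j)
  refine ⟨d, ?_⟩
  ext i j
  rw [Matrix.mul_diagonal, Matrix.mul_apply, hQ]
  simp_rw [hQ]
  have := congrFun (hd j) i
  rw [← Module.Basis.reindex_apply] at this
  simpa [Matrix.mulVec, dotProduct, mul_comm, b'] using this

/-! ### `p`-groups of matrices congruent to the identity -/

section CongruenceSubgroup

variable {R : Type*} [CommRing R]

/-- Substitute `1 + (ζ - 1) X` into `X ^ p - 1 = ∏ (X - ζ ^ i)` and use `ζ ^ i - 1 = (ζ - 1) * ∑ k <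
i, ζ ^ k`. -/
theorem prod_X_sub_C_geom_sum_eq [IsDomain R] {p : ℕ} {ζ : R} (hζ : IsPrimitiveRoot ζ p)
    (hp : 0 < p) :
    Polynomial.C ((ζ - 1) ^ p) *
        ∏ i ∈ Finset.range p, (Polynomial.X - Polynomial.C (∑ k ∈ Finset.range i, ζ ^ k)) =
      (1 + Polynomial.C (ζ - 1) * Polynomial.X) ^ p - 1 := by
  have h := congrArg (fun q => Polynomial.comp q (1 + Polynomial.C (ζ - 1) * Polynomial.X))
    (X_pow_sub_C_eq_prod hζ hp (one_pow p))
  simp only [mul_one, map_one, Polynomial.sub_comp, Polynomial.X_pow_comp, Polynomial.one_comp,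
    Polynomial.prod_comp, Polynomial.X_comp, Polynomial.C_comp] at h
  rw [h, map_pow, ← Finset.card_range p, ← Finset.prod_const, Finset.card_range,
    ← Finset.prod_mul_distrib]
  refine Finset.prod_congr rfl fun i _ => ?_
  rw [mul_sub, ← map_mul, mul_geom_sum, map_sub, map_sub, map_one]
  ring

theorem aeval_prod_X_sub_C_geom_sum_eq_zero [IsDomain R] {p : ℕ} {ζ : R}
    (hζ : IsPrimitiveRoot ζ p) (hp : 1 < p) {n : ℕ} (N : Matrix (Fin n) (Fin n) R)
    (hN : (1 + (ζ - 1) • N) ^ p = 1) :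
    Polynomial.aeval N
      (∏ i ∈ Finset.range p, (Polynomial.X - Polynomial.C (∑ k ∈ Finset.range i, ζ ^ k))) = 0 := by
  have h := congrArg (Polynomial.aeval N) (prod_X_sub_C_geom_sum_eq hζ hp.le)
  have hζ1 : ζ - 1 ≠ 0 := sub_ne_zero.mpr (hζ.ne_one hp)
  rw [map_mul, Polynomial.aeval_C, ← Algebra.smul_def, map_sub, map_pow (Polynomial.aeval N),
    map_add, map_one, map_mul, Polynomial.aeval_C, Polynomial.aeval_X, ← Algebra.smul_def, hN, sub_self, smul_eq_zero_iff_right (pow_ne_zero p hζ1)] at h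
  exact h

/-- For `j < i` the difference is `ζ ^ j` times the cyclotomic unit `(ζ ^ (i - j) - 1)/(ζ - 1)`. -/
theorem isUnit_geom_sum_sub_geom_sum [IsDomain R] {p : ℕ} (hp : p.Prime) {ζ : R}
    (hζ : IsPrimitiveRoot ζ p) {i j : ℕ} (hi : i < p) (hj : j < p) (hij : i ≠ j) :
    IsUnit (∑ k ∈ Finset.range i, ζ ^ k - ∑ k ∈ Finset.range j, ζ ^ k) := by
  wlog h : j < i generalizing i j
  · rw [← neg_sub, IsUnit.neg_iff]
    exact this hj hi hij.symm (by omega)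
  obtain ⟨l, rfl⟩ := Nat.exists_eq_add_of_lt h
  rw [add_assoc, Finset.sum_range_add, add_sub_cancel_left]
  simp_rw [pow_add _ j, ← Finset.mul_sum]
  refine (hζ.isUnit hp.ne_zero).pow j |>.mul (hζ.geom_sum_isUnit hp.two_le ?_)
  exact (Nat.coprime_of_lt_prime (by omega) (by omega) hp).symm

theorem eq_zero_of_pow_eq_one [IsDomain R] [IsLocalRing R] {p : ℕ} (hp : p.Prime) {ζ : R}
    (hζ : IsPrimitiveRoot ζ p) (hζm : ζ - 1 ∈ maximalIdeal R) {n : ℕ}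
    (N : Matrix (Fin n) (Fin n) R) (h : (1 + (ζ - 1) • (ζ - 1) • N) ^ p = 1) : N = 0 := by
  have h0 := aeval_prod_X_sub_C_geom_sum_eq_zero hζ hp.one_lt _ h
  have hζ1 : ζ - 1 ≠ 0 := sub_ne_zero.mpr (hζ.ne_one hp.one_lt)
  obtain ⟨m, rfl⟩ : ∃ m, p = m + 1 := ⟨p - 1, (Nat.succ_pred_eq_of_pos hp.pos).symm⟩
  -- The factor for index `0` is `X` itself, contributing `(ζ - 1) • N`. The other factors are
  -- invertible, being nonzero scalars modulo the maximal ideal.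
  rw [Finset.prod_range_succ', map_mul] at h0
  simp only [Finset.range_zero, Finset.sum_empty, map_zero, sub_zero, Polynomial.aeval_X] at h0
  have hu : IsUnit (Polynomial.aeval ((ζ - 1) • N) (∏ i ∈ Finset.range m,
      (Polynomial.X - Polynomial.C (∑ k ∈ Finset.range (i + 1), ζ ^ k)))) := by
    refine Finset.prod_induction _ (fun q => IsUnit (Polynomial.aeval ((ζ - 1) • N) q)) ?_ ?_ ?_
    · intro q q' hq hq'
      rw [map_mul]
      exact hq.mul hq'
    · simp
    · intro i hi
      have hi := Finset.mem_range.mp hi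
      have hu : IsUnit (∑ k ∈ Finset.range (i + 1), ζ ^ k) := hζ.geom_sum_isUnit hp.two_le
        (Nat.coprime_of_lt_prime (by omega) (by omega) hp).symm
      simp only [map_sub, Polynomial.aeval_X, Polynomial.aeval_C]
      rw [Matrix.isUnit_iff_isUnit_det]
      refine isUnit_of_map_unit (residue R) _ ?_
      have hmap : (residue R).mapMatrix
          ((ζ - 1) • N - algebraMap R _ (∑ k ∈ Finset.range (i + 1), ζ ^ k)) =
          -Matrix.scalar (Fin n) (residue R (∑ k ∈ Finset.range (i + 1), ζ ^ k)) := by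
        ext a b
        have h0 : residue R (ζ - 1) = 0 := (residue_eq_zero_iff _).mpr hζm
        by_cases hab : a = b <;>
          simp [Matrix.algebraMap_matrix_apply, h0, hab, Matrix.scalar_apply, -map_sum]
      rw [RingHom.map_det, hmap, ← Matrix.isUnit_iff_isUnit_det, IsUnit.neg_iff]
      exact (hu.map (residue R)).map (Matrix.scalar (Fin n))
  have := hu.mul_right_eq_zero.mp h0
  rwa [smul_eq_zero_iff_right hζ1] at this

theorem exists_one_add_pow_eq {p : ℕ} {π : R} (hpπ : π ∣ (p : R)) {A : Type*} [Ring A] [Algebra R A]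
    (N : A) : ∃ N' : A, (1 + π • N) ^ p = 1 + π • π • N' := by
  obtain ⟨c, hc⟩ := hpπ
  obtain ⟨k, hk⟩ := Polynomial.powAddExpansion (1 : Polynomial R) Polynomial.X p
  have h := congrArg (Polynomial.aeval (π • N)) hk
  simp only [map_mul, map_pow, map_add, map_one, Polynomial.aeval_X, one_pow, mul_one,
    map_natCast] at h
  -- With `x = π • N`, expand `(1 + x) ^ p = 1 + p x + k x ^ 2`; the linear term gains a second `π`
  -- from `p = π * c`.
  refine ⟨c • N + Polynomial.aeval (π • N) k * N ^ 2, ?_⟩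
  have hp : (p : A) = algebraMap R A (π * c) := by rw [← hc, map_natCast]
  rw [h, hp, ← Algebra.smul_def, smul_pow, mul_smul_comm, smul_add, smul_add, add_assoc]
  congr 2
  · rw [smul_smul, smul_smul, smul_smul]
    ring_nf
  · rw [smul_smul, sq π]

theorem pow_eq_one_of_pow_prime_pow_eq_one [IsDomain R] [IsLocalRing R] {p : ℕ} (hp : p.Prime)
    {ζ : R} (hζ : IsPrimitiveRoot ζ p) (hζm : ζ - 1 ∈ maximalIdeal R) (hpζ : ζ - 1 ∣ (p : R))
    {n : ℕ} (N : Matrix (Fin n) (Fin n) R) (k : ℕ) (h : (1 + (ζ - 1) • N) ^ p ^ k = 1) :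
    (1 + (ζ - 1) • N) ^ p = 1 := by
  induction k with
  | zero => rw [pow_zero, pow_one] at h; rw [h, one_pow]
  | succ k ih =>
    cases k with
    | zero => simpa using h
    | succ k =>
      refine ih ?_
      have hc : ∀ m : ℕ, ∃ N' : Matrix (Fin n) (Fin n) R,
          (1 + (ζ - 1) • N) ^ m = 1 + (ζ - 1) • N' := by
        intro m
        induction m with
        | zero => exact ⟨0, by simp⟩
        | succ m ihm =>
          obtain ⟨N', hN'⟩ := ihm
          refine ⟨N' + N + N' * ((ζ - 1) • N), ?_⟩
          rw [pow_succ, hN']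
          simp only [mul_add, add_mul, smul_add, smul_mul_assoc, one_mul, mul_one]
          abel
      -- The `p ^ (k + 1)`-th power is `1` modulo `π²` and its `p`-th power is `1`, so rigidity
      -- makes it `1` already.
      obtain ⟨N', hN'⟩ := hc (p ^ k)
      obtain ⟨N'', hN''⟩ := exists_one_add_pow_eq hpζ N'
      rw [pow_succ (n := k + 1), pow_mul, pow_succ, pow_mul, hN', hN''] at h
      have := eq_zero_of_pow_eq_one hp hζ hζm N'' h
      rw [pow_succ, pow_mul, hN', hN'', this]
      simp

theorem IsPGroup.exists_diagonalization [IsDomain R] [IsLocalRing R] [IsNoetherianRing R] {p : ℕ}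
    (hp : p.Prime) {ζ : R} (hζ : IsPrimitiveRoot ζ p) (hζm : ζ - 1 ∈ maximalIdeal R)
    (hpζ : ζ - 1 ∣ (p : R)) {n : ℕ} {G : Subgroup (GL (Fin n) R)} (hG : IsPGroup p G)
    (hcongr : ∀ g ∈ G, ∃ N : Matrix (Fin n) (Fin n) R, g.1 = 1 + (ζ - 1) • N) :
    ∃ Q : GL (Fin n) R, ∀ g ∈ G, ∃ d : Fin n → R, (∀ i, d i ^ p = 1) ∧
      g.1 * Q.1 = Q.1 * Matrix.diagonal d := by
  have hζ1 : ζ - 1 ≠ 0 := sub_ne_zero.mpr (hζ.ne_one hp.one_lt)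
  have hpow : ∀ g ∈ G, g.1 ^ p = 1 := by
    intro g hg
    obtain ⟨N, hN⟩ := hcongr g hg
    obtain ⟨k, hk⟩ := hG ⟨g, hg⟩
    have hk' : g.1 ^ p ^ k = 1 := by
      have := congrArg (fun x : G => x.1.1) hk
      simpa using this
    rw [hN] at hk' ⊢
    exact pow_eq_one_of_pow_prime_pow_eq_one hp hζ hζm hpζ N k hk'
  have hcomm : ∀ g ∈ G, ∀ h ∈ G, Commute g h := by
    intro g hg h hh
    obtain ⟨N, hN⟩ := hcongr g hg
    obtain ⟨M, hM⟩ := hcongr h hh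
    -- The linear terms of `g h` and `h g` agree, so the commutator is `1` modulo `π²` and rigidity
    -- applies to it.
    have h1 : (g * h * g⁻¹ * h⁻¹).1 =
        1 + (ζ - 1) • (ζ - 1) • ((N * M - M * N) * (g⁻¹ * h⁻¹ : GL (Fin n) R).1) := by
      have h2 : g.1 * h.1 = h.1 * g.1 + (ζ - 1) • (ζ - 1) • (N * M - M * N) := by
        rw [hN, hM]
        simp only [mul_add, add_mul, smul_mul_assoc, mul_smul_comm, smul_sub, smul_add, one_mul,
          mul_one]
        abel
      have h3 : (h * g).1 * (g⁻¹ * h⁻¹ : GL (Fin n) R).1 = 1 := by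
        rw [← Units.val_mul, ← mul_inv_rev, mul_inv_cancel, Units.val_one]
      rw [mul_assoc, Units.val_mul, Units.val_mul, h2, add_mul, ← Units.val_mul, h3,
        smul_mul_assoc, smul_mul_assoc]
    have h4 := hpow _ (G.mul_mem (G.mul_mem (G.mul_mem hg hh) (G.inv_mem hg)) (G.inv_mem hh))
    rw [h1] at h4
    have h5 := eq_zero_of_pow_eq_one hp hζ hζm _ h4
    rw [h5, smul_zero, smul_zero, add_zero, ← Units.val_one, Units.val_inj,
      mul_inv_eq_one, mul_inv_eq_iff_eq_mul] at h1
    exact h1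
  obtain ⟨Q, hQ⟩ := Matrix.exists_simultaneous_diagonalization
    (fun i => ∑ k ∈ Finset.range i, ζ ^ k) (Finset.range p)
    (fun i hi j hj hij => isUnit_geom_sum_sub_geom_sum hp hζ (Finset.mem_range.mp hi)
      (Finset.mem_range.mp hj) hij)
    {N : Matrix (Fin n) (Fin n) R | ∃ g ∈ G, g.1 = 1 + (ζ - 1) • N}
    (by
      rintro N ⟨g, hg, hN⟩ M ⟨h, hh, hM⟩
      have h1 := congrArg Units.val (hcomm g hg h hh).eq
      rw [Units.val_mul, Units.val_mul, hN, hM] at h1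
      have h2 : (ζ - 1) • (ζ - 1) • (N * M) = (ζ - 1) • (ζ - 1) • (M * N) := by
        simp only [mul_add, add_mul, smul_mul_assoc, mul_smul_comm, smul_add, one_mul,
          mul_one] at h1
        rw [← sub_eq_zero] at h1 ⊢
        rw [← h1]
        abel
      exact smul_right_injective _ hζ1 (smul_right_injective _ hζ1 h2))
    (by
      rintro N ⟨g, hg, hN⟩
      exact aeval_prod_X_sub_C_geom_sum_eq_zero hζ hp.one_lt N (hN ▸ hpow g hg))
  refine ⟨Q, fun g hg => ?_⟩
  obtain ⟨N, hN⟩ := hcongr g hg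
  obtain ⟨d, hd⟩ := hQ N ⟨g, hg, hN⟩
  have hdiag : g.1 * Q.1 = Q.1 * Matrix.diagonal (fun i => 1 + (ζ - 1) * d i) := by
    have : (Matrix.diagonal fun i => 1 + (ζ - 1) * d i) = 1 + (ζ - 1) • Matrix.diagonal d := by
      ext i j
      by_cases hij : i = j <;> simp [hij]
    rw [hN, this, add_mul, smul_mul_assoc, hd, mul_add, mul_smul_comm, one_mul, mul_one]
  refine ⟨_, fun i => ?_, hdiag⟩
  -- Conjugating `g ^ p = 1` by `Q` gives the same relation for the diagonal matrix, hence for each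
  -- entry.
  have hsemi : SemiconjBy Q.1 (Matrix.diagonal fun i => 1 + (ζ - 1) * d i) g.1 := hdiag.symm
  have h := (hsemi.pow_right p).eq
  rw [hpow g hg, one_mul] at h
  have h' : Matrix.diagonal (fun i => 1 + (ζ - 1) * d i) ^ p = 1 :=
    Q.isUnit.mul_left_cancel (h.trans (mul_one _).symm)
  rw [Matrix.diagonal_pow] at h'
  simpa using congrFun (congrFun h' i) i

end CongruenceSubgroup

/-! ### Monomial subalgebras -/

section MonomialSubalgebra

variable {σ R : Type*} [CommRing R]

/-- Uniqueness of division by `p` in each exponent keeps different remainders `r` from overlapping;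
this yields the linear independence of the remainder monomials. -/
theorem MvPolynomial.coeff_expand_mul_monomial [DecidableEq σ] {p : ℕ} (hp : p ≠ 0) (f : MvPolynomial σ R)
    (r s : σ →₀ ℕ) (hr : ∀ i, r i < p) (hs : ∀ i, s i < p) (m : σ →₀ ℕ) :
    (MvPolynomial.expand p f * MvPolynomial.monomial r 1).coeff (p • m + s) =
      if r = s then f.coeff m else 0 := by
  classical
  rw [MvPolynomial.coeff_mul_monomial']
  split_ifs with hle hrs hrs
  · subst hrs
    rw [add_tsub_cancel_right, mul_one, MvPolynomial.coeff_expand_smul p hp]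
  · rw [mul_one]
    obtain ⟨i, hi⟩ := Finsupp.ne_iff.mp hrs
    refine MvPolynomial.coeff_expand_of_not_dvd f (i := i) fun hdvd => hi ?_
    have hlei := hle i
    simp only [Finsupp.tsub_apply, Finsupp.add_apply, Finsupp.smul_apply, smul_eq_mul] at hdvd hlei
    have h := (Nat.modEq_iff_dvd' hlei).mpr hdvd
    rw [Nat.ModEq, Nat.mul_add_mod, Nat.mod_eq_of_lt (hr i), Nat.mod_eq_of_lt (hs i)] at h
    exact h
  · exact absurd (hrs ▸ le_add_self) hle
  · rfl

/-- A subalgebra of a polynomial ring that consists of the polynomials supported on a set of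
exponents stable under translation by `p` times any exponent is finite and free over the polynomial
ring, which acts through the substitution `X_i ↦ X_i ^ p`. -/
theorem MvPolynomial.finite_free_of_monomial_subalgebra [Finite σ] {p : ℕ} (hp : 0 < p)
    (W : Set (σ →₀ ℕ)) (hW : ∀ m q, p • q + m ∈ W ↔ m ∈ W) (A : Subalgebra R (MvPolynomial σ R))
    (hA : ∀ f, f ∈ A ↔ ∀ m ∈ f.support, m ∈ W) [Algebra (MvPolynomial σ R) A]
    (hmap : ∀ f : MvPolynomial σ R,
      (algebraMap (MvPolynomial σ R) A f : MvPolynomial σ R) = MvPolynomial.expand p f) :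
    Module.Finite (MvPolynomial σ R) A ∧ Module.Free (MvPolynomial σ R) A := by
  classical
  have := Fintype.ofFinite σ
  let e : (σ → Fin p) → σ →₀ ℕ := fun r => Finsupp.equivFunOnFinite.symm fun i => (r i : ℕ)
  have he : ∀ r i, e r i < p := fun r i => (r i).2
  have hinj : Function.Injective e := fun r s h => by
    ext i
    exact DFunLike.congr_fun h i
  have hmonomial : ∀ m ∈ W, ∀ c : R, MvPolynomial.monomial m c ∈ A := fun m hm c => by
    rw [hA]
    intro m' hm'
    rwa [Finset.mem_singleton.mp (MvPolynomial.support_monomial_subset hm')]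
  let v : {r : σ → Fin p // e r ∈ W} → A := fun r =>
    ⟨MvPolynomial.monomial (e r) 1, hmonomial _ r.2 1⟩
  have hsmul : ∀ (f : MvPolynomial σ R) (x : A),
      ((f • x : A) : MvPolynomial σ R) = MvPolynomial.expand p f * x := fun f x => by
    rw [Algebra.smul_def, MulMemClass.coe_mul, hmap]
  have hli : LinearIndependent (MvPolynomial σ R) v := by
    rw [Fintype.linearIndependent_iff]
    intro g hg s
    ext m
    have h := congrArg (fun x : A => (x : MvPolynomial σ R).coeff (p • m + e s)) hg
    simp only [AddSubmonoidClass.coe_finsetSum, hsmul, MvPolynomial.coeff_sum, v,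
      coeff_expand_mul_monomial hp.ne' _ _ _ (he _) (he _), ZeroMemClass.coe_zero,
      MvPolynomial.coeff_zero] at h
    rw [Finset.sum_eq_single s] at h
    · simpa using h
    · intro b _ hb
      rw [if_neg fun h => hb (Subtype.ext (hinj h))]
    · simp
  have hspan : ⊤ ≤ Submodule.span (MvPolynomial σ R) (Set.range v) := by
    rintro f -
    have hf := (hA f).mp f.2
    have hsum : f = ∑ m ∈ (f : MvPolynomial σ R).support.attach,
        (⟨MvPolynomial.monomial m.1 ((f : MvPolynomial σ R).coeff m.1),
          hmonomial _ (hf _ m.2) _⟩ : A) := by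
      refine Subtype.ext ?_
      rw [AddSubmonoidClass.coe_finsetSum]
      conv_lhs => rw [MvPolynomial.as_sum (f : MvPolynomial σ R)]
      rw [← Finset.sum_attach]
    rw [hsum]
    refine Submodule.sum_mem _ fun m _ => ?_
    let q : σ →₀ ℕ := Finsupp.equivFunOnFinite.symm fun i => m.1 i / p
    let r : σ → Fin p := fun i => ⟨m.1 i % p, Nat.mod_lt _ hp⟩
    have hm : p • q + e r = m.1 := by
      ext i
      simp [q, r, e, Nat.div_add_mod]
    have hr : e r ∈ W := by
      rw [← hW _ q, hm]
      exact hf _ m.2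
    have : (⟨MvPolynomial.monomial m.1 ((f : MvPolynomial σ R).coeff m.1),
        hmonomial _ (hf _ m.2) _⟩ : A) =
        MvPolynomial.monomial q ((f : MvPolynomial σ R).coeff m.1) • v ⟨r, hr⟩ := by
      refine Subtype.ext ?_
      rw [hsmul, MvPolynomial.expand_monomial]
      simp only [v]
      rw [MvPolynomial.monomial_mul, mul_one, hm]
    rw [this]
    exact Submodule.smul_mem _ _ (Submodule.subset_span ⟨_, rfl⟩)
  let b := Module.Basis.mk hli hspan
  exact ⟨.of_basis b, .of_basis b⟩

end MonomialSubalgebra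

/-! ### Invariants of diagonal groups -/

section Invariants

variable {n : ℕ} {R : Type*} [CommRing R]

theorem linearAction_diagonal_monomial {g : GL (Fin n) R} {d : Fin n → R}
    (hg : g.1 = Matrix.diagonal d) (m : Fin n →₀ ℕ) (c : R) :
    linearAction n R g (MvPolynomial.monomial m c) =
      MvPolynomial.monomial m (c * ∏ i, d i ^ m i) := by
  have hX : ∀ j, linearAction n R g (MvPolynomial.X j) =
      MvPolynomial.C (d j) * MvPolynomial.X j := fun j => by
    simp only [linearAction, MonoidHom.coe_mk, OneHom.coe_mk, MvPolynomial.aeval_X, hg]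
    rw [Finset.sum_eq_single j]
    · simp
    · intro i _ hij
      simp [Matrix.diagonal_apply_ne _ hij]
    · simp
  rw [MvPolynomial.monomial_eq, MvPolynomial.monomial_eq, map_mul, Finsupp.prod_fintype _ _ (by simp),
    map_prod]
  simp only [map_pow, hX, mul_pow, Finset.prod_mul_distrib, map_mul, map_prod]
  rw [← MvPolynomial.algebraMap_eq, AlgHom.commutes, mul_assoc]

theorem coeff_linearAction_diagonal {g : GL (Fin n) R} {d : Fin n → R}
    (hg : g.1 = Matrix.diagonal d) (f : MvPolynomial (Fin n) R) (m : Fin n →₀ ℕ) :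
    (linearAction n R g f).coeff m = f.coeff m * ∏ i, d i ^ m i := by
  induction f using MvPolynomial.induction_on' with
  | monomial u a =>
    classical
    rw [linearAction_diagonal_monomial hg, MvPolynomial.coeff_monomial, MvPolynomial.coeff_monomial]
    split_ifs with h
    · rw [h]
    · rw [zero_mul]
  | add p q hp hq => rw [map_add, MvPolynomial.coeff_add, hp, hq, MvPolynomial.coeff_add, add_mul]

theorem mem_invariantRing_of_diagonal [IsDomain R] {G : Subgroup (GL (Fin n) R)}
    (d : GL (Fin n) R → Fin n → R) (hd : ∀ g ∈ G, g.1 = Matrix.diagonal (d g))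
    (f : MvPolynomial (Fin n) R) :
    f ∈ invariantRing G ↔ ∀ m ∈ f.support, ∀ g ∈ G, ∏ i, d g i ^ m i = 1 := by
  rw [mem_invariantRing]
  constructor
  · intro h m hm g hg
    have := congrArg (MvPolynomial.coeff m) (h g hg)
    rw [coeff_linearAction_diagonal (hd g hg)] at this
    exact (mul_eq_left₀ (MvPolynomial.mem_support_iff.mp hm)).mp this
  · intro h g hg
    ext m
    rw [coeff_linearAction_diagonal (hd g hg)]
    by_cases hm : m ∈ f.support
    · rw [h m hm g hg, mul_one]
    · rw [MvPolynomial.notMem_support_iff.mp hm, zero_mul]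

theorem invariantRing_of_diagonal [IsDomain R] [IsNoetherianRing R]
    (hR : LocallyHasRegularParameters R) {G : Subgroup (GL (Fin n) R)} {p : ℕ} (hp : 0 < p)
    (hG : ∀ g ∈ G, ∃ d : Fin n → R, (∀ i, d i ^ p = 1) ∧ g.1 = Matrix.diagonal d) :
    IsNoetherianRing (invariantRing G) ∧ LocallyHasRegularParameters (invariantRing G) := by
  choose! d hdp hd using hG
  let W : Set (Fin n →₀ ℕ) := {m | ∀ g ∈ G, ∏ i, d g i ^ m i = 1}
  have hW : ∀ m q, p • q + m ∈ W ↔ m ∈ W := fun m q => by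
    have : ∀ g ∈ G, ∏ i, d g i ^ (p • q + m) i = ∏ i, d g i ^ m i := fun g hg => by
      refine Finset.prod_congr rfl fun i _ => ?_
      rw [Finsupp.add_apply, Finsupp.smul_apply, smul_eq_mul, pow_add, pow_mul, hdp g hg, one_pow,
        one_mul]
    exact ⟨fun h g hg => (this g hg).symm.trans (h g hg), fun h g hg => (this g hg).trans (h g hg)⟩
  have hA := mem_invariantRing_of_diagonal d hd
  have hmem : ∀ f : MvPolynomial (Fin n) R, MvPolynomial.expand p f ∈ invariantRing G := by
    intro f
    rw [hA]
    intro m hm g hg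
    refine Finset.prod_eq_one fun i _ => ?_
    by_contra hne
    refine MvPolynomial.mem_support_iff.mp hm
      (MvPolynomial.coeff_expand_of_not_dvd f (i := i) fun ⟨k, hk⟩ => hne ?_)
    rw [hk, pow_mul, hdp g hg, one_pow]
  let φ : MvPolynomial (Fin n) R →ₐ[R] invariantRing G := (MvPolynomial.expand p).codRestrict _ hmem
  let _ : Algebra (MvPolynomial (Fin n) R) (invariantRing G) := φ.toRingHom.toAlgebra
  obtain ⟨_, _⟩ := MvPolynomial.finite_free_of_monomial_subalgebra hp W hW (invariantRing G) hA
    fun f => rfl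
  exact ⟨IsNoetherianRing.of_finite (MvPolynomial (Fin n) R) _,
    (hR.mvPolynomial (Fin n)).of_finite_of_flat⟩

theorem linearAction_mem_invariantRing {G : Subgroup (GL (Fin n) R)} (Q : GL (Fin n) R)
    {f : MvPolynomial (Fin n) R} (hf : f ∈ invariantRing G) :
    linearAction n R Q f ∈ invariantRing (G.map (MulAut.conj Q).toMonoidHom) := by
  rw [mem_invariantRing] at hf ⊢
  rintro _ ⟨g, hg, rfl⟩
  rw [← AlgHom.mul_apply, ← map_mul]
  have : (MulAut.conj Q).toMonoidHom g * Q = Q * g := by simp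
  rw [this, map_mul, AlgHom.mul_apply, hf g hg]

/-- Conjugate linear groups have isomorphic invariant rings. -/
noncomputable def invariantRingConjEquiv (G : Subgroup (GL (Fin n) R)) (Q : GL (Fin n) R) :
    invariantRing G ≃+* invariantRing (G.map (MulAut.conj Q).toMonoidHom) :=
  RingEquiv.ofBijective
    (((linearAction n R Q).comp (invariantRing G).val).codRestrict
      (invariantRing (G.map (MulAut.conj Q).toMonoidHom))
      fun f => linearAction_mem_invariantRing Q f.2) <| by
    have hinv : ∀ (P : GL (Fin n) R) (f : MvPolynomial (Fin n) R),
        linearAction n R P⁻¹ (linearAction n R P f) = f := fun P f => by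
      rw [← AlgHom.mul_apply, ← map_mul, inv_mul_cancel, map_one]
      rfl
    constructor
    · intro f g h
      refine Subtype.ext ?_
      have h' : linearAction n R Q f = linearAction n R Q g := congrArg Subtype.val h
      rw [← hinv Q f, h', hinv]
    · intro f
      have h := linearAction_mem_invariantRing Q⁻¹ f.2
      have hG : (G.map (MulAut.conj Q).toMonoidHom).map (MulAut.conj Q⁻¹).toMonoidHom = G := by
        rw [Subgroup.map_map]
        convert! Subgroup.map_id G
        ext g : 1
        simp [mul_assoc]
      rw [hG] at h
      refine ⟨⟨_, h⟩, Subtype.ext ?_⟩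
      have := hinv Q⁻¹ f
      rw [inv_inv] at this
      exact this

end Invariants

/-! ### The local ring of the Hilbert class field at a prime above `p` -/

/-- The prime of `𝓞 K` below `P` contains `p`, hence is `(ζ - 1)` by total ramification;
unramifiedness at `P` makes it generate the maximal ideal upstairs. -/
theorem map_span_zeta_sub_one_eq_maximalIdeal (p : ℕ) [Fact p.Prime]
    {K : Type*} [Field K] [NumberField K] [IsCyclotomicExtension {p} ℚ K]
    {H : Type*} [Field H] [NumberField H] [Algebra K H]
    (P : Ideal (𝓞 H)) [P.IsPrime] [Algebra.IsUnramifiedAt (𝓞 K) P] (hP : (p : 𝓞 H) ∈ P)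
    {ζ : K} (hζ : IsPrimitiveRoot ζ p) :
    maximalIdeal (Localization.AtPrime P) =
      Ideal.span {algebraMap (𝓞 K) (Localization.AtPrime P) hζ.toInteger - 1} := by
  let q := P.under (𝓞 K)
  let _ := Localization.AtPrime.algebraOfLiesOver q P
  have hq : q.LiesOver (Ideal.span {(p : ℤ)}) := by
    refine ⟨(Int.ideal_span_isMaximal_of_prime p).eq_of_le Ideal.IsPrime.ne_top' ?_⟩
    rw [Ideal.span_singleton_le_iff_mem]
    simpa [q] using hP
  have h := ((Algebra.isUnramifiedAt_iff_map_eq (𝓞 K) q P).mp inferInstance).2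
  rw [← h, IsCyclotomicExtension.Rat.eq_span_zeta_sub_one_of_liesOver' p K hζ q, Ideal.map_span,
    Set.image_singleton, map_sub, map_one]

theorem exists_eq_one_add_smul_of_map_eq_one {R : Type*} [CommRing R] {n : ℕ} {π : R} {I : Ideal R}
    (hI : I = Ideal.span {π}) {g : GL (Fin n) R}
    (hg : Matrix.GeneralLinearGroup.map (Ideal.Quotient.mk I) g = 1) :
    ∃ N : Matrix (Fin n) (Fin n) R, g.1 = 1 + π • N := by
  have h : ∀ i j, ∃ c, g.1 i j - (1 : Matrix (Fin n) (Fin n) R) i j = π * c := fun i j => by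
    rw [← dvd_def, ← Ideal.mem_span_singleton, ← hI, ← Ideal.Quotient.eq_zero_iff_mem, map_sub,
      sub_eq_zero]
    have := congrArg (fun x : GL (Fin n) (R ⧸ I) => x.1 i j) hg
    simpa [Matrix.one_apply, apply_ite (Ideal.Quotient.mk I)] using this
  choose N hN using h
  refine ⟨Matrix.of N, ?_⟩
  ext i j
  simp [← hN]

theorem invariantRing_isCohenMacaulayRing {R : Type*} [CommRing R] [IsLocalRing R]
    [IsDedekindDomain R] {p : ℕ} (hp : p.Prime) {ζ : R} (hζ : IsPrimitiveRoot ζ p)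
    (hm : maximalIdeal R = Ideal.span {ζ - 1}) (hpm : (p : R) ∈ maximalIdeal R) {n : ℕ}
    {G : Subgroup (GL (Fin n) R)} (hG : IsPGroup p G)
    (htriv : ∀ g ∈ G, Matrix.GeneralLinearGroup.map (Ideal.Quotient.mk (maximalIdeal R)) g = 1) :
    IsCohenMacaulayRing (invariantRing G) := by
  obtain ⟨Q, hQ⟩ := hG.exists_diagonalization hp hζ (hm ▸ Ideal.mem_span_singleton_self _)
    (Ideal.mem_span_singleton.mp (hm ▸ hpm))
    fun g hg => exists_eq_one_add_smul_of_map_eq_one hm (htriv g hg)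
  -- The relation `g Q = Q D` means `Q⁻¹ g Q = D`, so conjugation is by `Q⁻¹`.
  let e := invariantRingConjEquiv G Q⁻¹
  obtain ⟨h, hreg⟩ := invariantRing_of_diagonal (.of_isDedekindDomain R) hp.pos
    (G := G.map (MulAut.conj Q⁻¹).toMonoidHom) (by
      rintro _ ⟨g, hg, rfl⟩
      obtain ⟨d, hdp, hd⟩ := hQ g hg
      refine ⟨d, hdp, ?_⟩
      have : ((MulAut.conj Q⁻¹).toMonoidHom g).1 = (Q⁻¹).1 * (g.1 * Q.1) := by
        simp [mul_assoc]
      rw [this, hd, ← mul_assoc, ← Units.val_mul, inv_mul_cancel, Units.val_one, one_mul])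
  have := isNoetherianRing_of_ringEquiv _ e.symm
  exact (hreg.of_ringEquiv e.symm).isCohenMacaulayRing

theorem theorem1p2 (p : ℕ) [Fact p.Prime]
    (K : Type*) [Field K] [NumberField K] [IsCyclotomicExtension {p} ℚ K]
    (H : Type*) [Field H] [NumberField H] [Algebra K H] (hH : IsHilbertClassField K H)
    (P : Ideal (𝓞 H)) [P.IsPrime] (hP : (p : 𝓞 H) ∈ P)
    (G : Subgroup (GL (Fin 3) (Localization.AtPrime P))) (hG : IsPGroup p G)
    (htriv : ∀ g ∈ G, Matrix.GeneralLinearGroup.map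
      (Ideal.Quotient.mk (IsLocalRing.maximalIdeal (Localization.AtPrime P))) g = 1) :
    IsCohenMacaulayRing (invariantRing G) := by
  have hζ := IsCyclotomicExtension.zeta_spec p ℚ K
  have := hH.isUnramifiedAt P
  have := IsLocalization.isDedekindDomain (𝓞 H) P.primeCompl_le_nonZeroDivisors
    (Localization.AtPrime P)
  have hinj : Function.Injective (algebraMap (𝓞 K) (Localization.AtPrime P)) := by
    rw [IsScalarTower.algebraMap_eq (𝓞 K) (𝓞 H), RingHom.coe_comp]
    exact (IsLocalization.injective _ P.primeCompl_le_nonZeroDivisors).comp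
      (FaithfulSMul.algebraMap_injective (𝓞 K) (𝓞 H))
  have hpm : (p : Localization.AtPrime P) ∈ maximalIdeal (Localization.AtPrime P) := by
    have := (IsLocalization.AtPrime.to_map_mem_maximal_iff (Localization.AtPrime P) P p).mpr hP
    rwa [map_natCast] at this
  exact invariantRing_isCohenMacaulayRing Fact.out (hζ.toInteger_isPrimitiveRoot.map_of_injective hinj)
    (map_span_zeta_sub_one_eq_maximalIdeal p P hP hζ) hpm hG htriv
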